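/- Throughout, a system is a nonzero finite-dimensional complex Hilbert space $\mathcal H$; $\mathcal D(\mathcal H)$ is its set of density operators and $\mathcal C(\mathcal H\to\mathcal K)$ the set of completely positive trace-preserving linear maps $\mathcal B(\mathcal H)\to\mathcal B(\mathcal K)$. As usual, $(\mathcal H_1\otimes\mathcal H_2)\otimes\mathcal H_3$ is identified with $\mathcal H_1\otimes(\mathcal H_2\otimes\mathcal H_3)$, and $\mathbb C\otimes\mathcal H$ and $\mathcal H\otimes\mathbb C$ with $\mathcal H$; also $\mathcal H^{\otimes 0}=\mathbb C$ and $\psi^{\otimes 0}=1$. A quantum resource theory consists of a compact set of states $\mathcal S(\mathcal H)\subseteq\mathcal D(\mathcal H)$ for every system $\mathcal H$, such that $\psi\in\mathcal S(\mathcal H)$ implies $\psi^{\otimes n}\in\mathcal S(\mathcal H^{\otimes n})$ for all $n$, and of a compact (possibly empty) set of free operations $\mathcal O(\mathcal H\to\mathcal K)\subseteq\mathcal C(\mathcal H\to\mathcal K)$ for all systems $\mathcal H,\mathcal K$, each of which maps $\mathcal S(\mathcal H)$ into $\mathcal S(\mathcal K)$, such that free operations are closed under composition and under tensor products, the identity map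 of every system is free, and the trace $\mathrm{tr}\in\mathcal C(\mathcal H\to\mathbb C)$ is free for every $\mathcal H$. For states $\phi\in\mathcal S(\mathcal H)$ and $\psi\in\mathcal S(\mathcal K)$ let $r_{\mathrm{conv}}(\phi\to\psi)\in[0,\infty]$ be the supremum of all real $r\ge 0$ for which there are an infinite set $I\subseteq\mathbb N$ and free operations $\mathcal N_m\in\mathcal O(\mathcal H^{\otimes m}\to\mathcal K^{\otimes\lceil rm\rceil})$, $m\in I$, with $$\lim_{m\to\infty,\ m\in I}\bigl\|\mathcal N_m(\phi^{\otimes m})-\psi^{\otimes\lceil rm\rceil}\bigr\|_1=0,$$ where $\|T\|_1=\mathrm{tr}\sqrt{T^\dagger T}$. With the normalization constant $R_{\max}^{(\mathcal H)}=\log_2(\dim\mathcal H)$, define the distillable resource and the resource cost of $\psi\in\mathcal S(\mathcal H)$ by $$R_{\mathrm D}(\psi)=\inf_{\phi\in\mathcal S(\mathcal H)} r_{\mathrm{conv}}(\psi\to\phi)\,R_{\max}^{(\mathcal H)},\qquad R_{\mathrm C}(\psi)=\inf_{\phi\in\mathcal S(\mathcal H)}\frac{R_{\max}^{(\mathcal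 H)}}{r_{\mathrm{conv}}(\phi\to\psi)},$$ with values in $[0,\infty]$ and the conventions $0\cdot\infty=0$, $a/0=\infty$ for $a>0$, $0/0=0$, and $a/\infty=0$ for finite $a\ge 0$. **Theorem (weak subadditivity of the distillable resource and the resource cost).** For every quantum resource theory, every system $\mathcal H$, every state $\psi\in\mathcal S(\mathcal H)$ and every $n\in\mathbb N$, $$R_{\mathrm D}(\psi^{\otimes n})\le n\,R_{\mathrm D}(\psi)\qquad\text{and}\qquad R_{\mathrm C}(\psi^{\otimes n})\le n\,R_{\mathrm C}(\psi).$$ -/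

import Mathlib

open scoped TensorProduct ComplexOrder

noncomputable section

/-- A finite-dimensional quantum system: a nonzero finite-dimensional complex Hilbert space. -/
structure QSystem where
  carrier : Type
  [normed : NormedAddCommGroup carrier]
  [inner : InnerProductSpace ℂ carrier]
  [finiteDim : FiniteDimensional ℂ carrier]
  [nontriv : Nontrivial carrier]

namespace QSystem

instance : CoeSort QSystem Type := ⟨QSystem.carrier⟩

instance (H : QSystem) : NormedAddCommGroup H := H.normed
instance (H : QSystem) : InnerProductSpace ℂ H := H.inner
instance (H : QSystem) : FiniteDimensional ℂ H := H.finiteDim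
instance (H : QSystem) : Nontrivial H := H.nontriv
instance (H : QSystem) : CompleteSpace H := FiniteDimensional.complete ℂ H

/-- The trivial system `ℂ`. -/
abbrev unit : QSystem := ⟨ℂ⟩

/-- The composite system `H ⊗ K`, with the Hilbert space tensor product. -/
abbrev tensor (H K : QSystem) : QSystem :=
  haveI : Nontrivial (H ⊗[ℂ] K) := by
    obtain ⟨x, hx⟩ := exists_ne (0 : H)
    obtain ⟨y, hy⟩ := exists_ne (0 : K)
    refine ⟨x ⊗ₜ y, 0, ?_⟩
    rw [← norm_ne_zero_iff, TensorProduct.norm_tmul]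
    exact mul_ne_zero (norm_ne_zero_iff.mpr hx) (norm_ne_zero_iff.mpr hy)
  ⟨H ⊗[ℂ] K⟩

/-- The `n`-fold tensor power `H^{⊗ n}`, with `H^{⊗ 0} = ℂ`. -/
def pow (H : QSystem) : ℕ → QSystem
  | 0 => unit
  | n + 1 => (H.pow n).tensor H

/-- The number of qubits `log₂ (dim H)` (nonnegative, since `dim H ≥ 1`). -/
def log2Dim (H : QSystem) : NNReal := (Real.logb 2 (Module.finrank ℂ H)).toNNReal

/-- `(H₁ ⊗ H₂) ⊗ H₃ ≃ H₁ ⊗ (H₂ ⊗ H₃)`. -/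
def assocIso (H₁ H₂ H₃ : QSystem) :
    (H₁.tensor H₂).tensor H₃ ≃ₗᵢ[ℂ] H₁.tensor (H₂.tensor H₃) :=
  TensorProduct.assocIsometry ℂ H₁ H₂ H₃

/-- `ℂ ⊗ H ≃ H`. -/
def lidIso (H : QSystem) : unit.tensor H ≃ₗᵢ[ℂ] H := TensorProduct.lidIsometry ℂ H

/-- `H ⊗ ℂ ≃ H`. -/
def ridIso (H : QSystem) : H.tensor unit ≃ₗᵢ[ℂ] H := TensorProduct.ridIsometry ℂ H

end QSystem

/-- Operators on `H` (all linear operators are bounded and trace class, as `dim H < ∞`). -/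
abbrev Op (H : QSystem) : Type := H →L[ℂ] H

namespace Op

/-- The trace. -/
def tr {H : QSystem} (T : Op H) : ℂ := LinearMap.trace ℂ H T.toLinearMap

/-- The trace norm `‖T‖₁ = tr |T|`, where `|T| = √(T† T)`. -/
def traceNorm {H : QSystem} (T : Op H) : ℝ := (tr (CFC.abs T)).re

/-- The tensor product `S ⊗ T`. -/
def tensor {H K : QSystem} (S : Op H) (T : Op K) : Op (H.tensor K) :=
  TensorProduct.mapL S T

/-- The tensor power `T^{⊗ n}`, with `T^{⊗ 0} = 1`. -/
def pow {H : QSystem} (T : Op H) : (n : ℕ) → Op (H.pow n)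
  | 0 => (1 : Op QSystem.unit)
  | n + 1 => (T.pow n).tensor T

/-- The canonical isomorphism `B(H) ⊗ B(K) ≃ B(H ⊗ K)`. -/
def tensorEquiv (H K : QSystem) : Op H ⊗[ℂ] Op K ≃ₗ[ℂ] Op (H.tensor K) :=
  (TensorProduct.congr (LinearMap.toContinuousLinearMap (𝕜 := ℂ) (E := H) (F' := H)).symm
      (LinearMap.toContinuousLinearMap (𝕜 := ℂ) (E := K) (F' := K)).symm).trans
    ((homTensorHomEquiv ℂ H K H K).trans
      (LinearMap.toContinuousLinearMap (𝕜 := ℂ) (E := H.tensor K) (F' := H.tensor K)))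

theorem tensorEquiv_tmul {H K : QSystem} (S : Op H) (T : Op K) :
    tensorEquiv H K (S ⊗ₜ T) = S.tensor T := by
  refine ContinuousLinearMap.coe_injective ?_
  change homTensorHomEquiv ℂ H K H K (S.toLinearMap ⊗ₜ T.toLinearMap) = _
  rw [homTensorHomEquiv_apply, TensorProduct.homTensorHomMap_apply]
  exact (TensorProduct.toLinearMap_mapL S T).symm

end Op

/-- `D(H)`: the density operators on `H`. -/
def densityOps (H : QSystem) : Set (Op H) := {ψ | 0 ≤ ψ ∧ ψ.tr = 1}

/-- Linear maps `B(H) → B(K)`. -/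
abbrev Superop (H K : QSystem) : Type := Op H →ₗ[ℂ] Op K

namespace Superop

open scoped CStarAlgebra in
/-- `C(H → K)`: completely positive and trace-preserving (CPTP) linear maps. -/
def IsChannel {H K : QSystem} (N : Superop H K) : Prop :=
  (∃ F : Op H →CP Op K, ∀ T, F T = N T) ∧ ∀ T, (N T).tr = T.tr

/-- The tensor product of two linear maps of operators. -/
def tensor {H₁ K₁ H₂ K₂ : QSystem} (M : Superop H₁ K₁) (N : Superop H₂ K₂) :
    Superop (H₁.tensor H₂) (K₁.tensor K₂) :=
  (Op.tensorEquiv K₁ K₂).toLinearMap ∘ₗ TensorProduct.map M N ∘ₗ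
    (Op.tensorEquiv H₁ H₂).symm.toLinearMap

theorem tensor_apply_tensor {H₁ K₁ H₂ K₂ : QSystem} (M : Superop H₁ K₁) (N : Superop H₂ K₂)
    (S : Op H₁) (T : Op H₂) : M.tensor N (S.tensor T) = (M S).tensor (N T) := by
  simp [tensor, ← Op.tensorEquiv_tmul]

/-- The trace, as a map from operators on `H` to operators on `ℂ`. -/
def trace (H : QSystem) : Superop H QSystem.unit :=
  LinearMap.smulRight (LinearMap.trace ℂ H ∘ₗ ContinuousLinearMap.coeLM ℂ)
    (1 : Op QSystem.unit)

/-- Conjugation `T ↦ U T U†` by a unitary identification `U : H ≃ K`. -/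
def ofIso {H K : QSystem} (U : H ≃ₗᵢ[ℂ] K) : Superop H K :=
  (U.conjStarAlgEquiv : Op H ≃⋆ₐ[ℂ] Op K).toAlgEquiv.toLinearMap

/-- The bounded weak topology: the weakest topology making `N ↦ tr (N(T) A)` continuous
for all `T` and `A`. -/
abbrev bwTopology (H K : QSystem) : TopologicalSpace (Superop H K) :=
  TopologicalSpace.induced (fun N (p : Op H × Op K) => Op.tr (N p.1 * p.2)) inferInstance

end Superop

/-- A quantum resource theory (QRT) on finite-dimensional systems: the sets `S(H)` of states under
consideration and the sets `O(H → K)` of free operations. -/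
structure QRT where
  /-- `S(H)`: a compact set of density operators. -/
  states : (H : QSystem) → Set (Op H)
  states_subset : ∀ H, states H ⊆ densityOps H
  states_compact : ∀ H, IsCompact (states H)
  /-- If `ψ ∈ S(H)`, then `ψ^{⊗ n} ∈ S(H^{⊗ n})`. -/
  states_pow : ∀ (H : QSystem), ∀ ψ ∈ states H, ∀ n : ℕ, ψ.pow n ∈ states (H.pow n)
  /-- `O(H → K)`: a compact set of channels that map `S(H)` to `S(K)`. -/
  free : (H K : QSystem) → Set (Superop H K)
  free_isChannel : ∀ H K, ∀ N ∈ free H K, N.IsChannel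
  free_mapsTo : ∀ H K, ∀ N ∈ free H K, Set.MapsTo N (states H) (states K)
  free_compact : ∀ H K, @IsCompact _ (Superop.bwTopology H K) (free H K)
  /-- Free operations are closed under composition. -/
  free_comp : ∀ H₁ H₂ H₃, ∀ M ∈ free H₁ H₂, ∀ N ∈ free H₂ H₃, N ∘ₗ M ∈ free H₁ H₃
  /-- Free operations are closed under tensor products. -/
  free_tensor : ∀ H₁ K₁ H₂ K₂, ∀ M ∈ free H₁ K₁, ∀ N ∈ free H₂ K₂,
    M.tensor N ∈ free (H₁.tensor H₂) (K₁.tensor K₂)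
  /-- The identity map is free. -/
  free_id : ∀ H, LinearMap.id ∈ free H H
  /-- The trace is free. -/
  free_trace : ∀ H, Superop.trace H ∈ free H QSystem.unit
  /-- The spaces `(H₁ ⊗ H₂) ⊗ H₃` and `H₁ ⊗ (H₂ ⊗ H₃)` are regarded as the same system, and so are
  `ℂ ⊗ H`, `H ⊗ ℂ` and `H`: the canonical identifications between them are free, being the
  identity map. -/
  free_assoc : ∀ H₁ H₂ H₃, Superop.ofIso (QSystem.assocIso H₁ H₂ H₃) ∈ free _ _
  free_assoc_symm : ∀ H₁ H₂ H₃, Superop.ofIso (QSystem.assocIso H₁ H₂ H₃).symm ∈ free _ _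
  free_lid : ∀ H, Superop.ofIso (QSystem.lidIso H) ∈ free _ _
  free_lid_symm : ∀ H, Superop.ofIso (QSystem.lidIso H).symm ∈ free _ _
  free_rid : ∀ H, Superop.ofIso (QSystem.ridIso H) ∈ free _ _
  free_rid_symm : ∀ H, Superop.ofIso (QSystem.ridIso H).symm ∈ free _ _

namespace QRT

/-- The set `R(φ → ψ)` of achievable rates: those `r ≥ 0` for which there are free operations
`N_n ∈ O(H^{⊗ n} → K^{⊗ ⌈r n⌉})`, for `n` in some infinite set of natural numbers (enumerated
increasingly as `n = k j`), along which `‖N_n(φ^{⊗ n}) - ψ^{⊗ ⌈r n⌉}‖₁` tends to `0`. -/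
def achievableRates (Q : QRT) {H K : QSystem} (φ : Op H) (ψ : Op K) : Set NNReal :=
  {r | ∃ k : ℕ → ℕ, StrictMono k ∧
    ∃ N : (j : ℕ) → Superop (H.pow (k j)) (K.pow ⌈r * (k j : NNReal)⌉₊),
      (∀ j, N j ∈ Q.free _ _) ∧
      Filter.Tendsto
        (fun j => Op.traceNorm (N j (φ.pow (k j)) - ψ.pow ⌈r * (k j : NNReal)⌉₊))
        Filter.atTop (nhds 0)}

/-- The asymptotic conversion rate `r_conv(φ → ψ) = sup R(φ → ψ)`, in `[0, ∞]`. -/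
def rconv (Q : QRT) {H K : QSystem} (φ : Op H) (ψ : Op K) : ENNReal :=
  ⨆ r ∈ Q.achievableRates φ ψ, (r : ENNReal)

/-- The distillable resource `R_D(ψ) = inf_{φ ∈ S(H)} r_conv(ψ → φ) R_max^{(H)}`, in `[0, ∞]`,
for the normalization constants `Rmax`. -/
def distillable (Q : QRT) (Rmax : QSystem → NNReal) {H : QSystem} (ψ : Op H) : ENNReal :=
  ⨅ φ ∈ Q.states H, Q.rconv ψ φ * (Rmax H : ENNReal)

/-- The resource cost `R_C(ψ) = inf_{φ ∈ S(H)} R_max^{(H)} / r_conv(φ → ψ)`, in `[0, ∞]`,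
for the normalization constants `Rmax`. -/
def cost (Q : QRT) (Rmax : QSystem → NNReal) {H : QSystem} (ψ : Op H) : ENNReal :=
  ⨅ φ ∈ Q.states H, (Rmax H : ENNReal) / Q.rconv φ ψ

end QRT

end

/-! ### Trace norm contraction under positive trace-preserving maps -/

namespace Op

variable {H : QSystem}

/-! For `n ≥ 1`, passing to `n`-th tensor powers of both source and target does not change the
conversion rate, whereas `log₂ dim` is multiplied by `n`. Testing the infima for `ψ^{⊗n}` only on
the powers `φ^{⊗n}` of states `φ ∈ S(H)` then gives both bounds. The distillable resource needs
`rconv_pow_pow_le`, the cost needs `rconv_le_rconv_pow_pow`. Both inequalities come from regrouping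
copies and discarding surplus ones. These operations are free and exact (`Convertible`), and
post-processing by a channel cannot increase the error (`traceNorm_map_le`). Rounding to multiples
of `n` costs a bounded number of copies, which any strict loss of rate absorbs. -/

theorem tr_add (S T : Op H) : (S + T).tr = S.tr + T.tr :=
  map_add (LinearMap.trace ℂ H) S.toLinearMap T.toLinearMap

theorem tr_sub (S T : Op H) : (S - T).tr = S.tr - T.tr :=
  map_sub (LinearMap.trace ℂ H) S.toLinearMap T.toLinearMap

theorem tr_mul_comm (S T : Op H) : (S * T).tr = (T * S).tr :=
  LinearMap.trace_mul_comm ℂ S.toLinearMap T.toLinearMap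

theorem tr_nonneg {T : Op H} (hT : 0 ≤ T) : 0 ≤ T.tr := by
  rw [ContinuousLinearMap.nonneg_iff_isPositive] at hT
  exact ((ContinuousLinearMap.isPositive_toLinearMap_iff T).mpr hT).trace_nonneg

/-- By cyclicity the trace equals that of the positive operator `√S T √S`. -/
theorem tr_mul_nonneg {S T : Op H} (hS : 0 ≤ S) (hT : 0 ≤ T) : 0 ≤ (S * T).tr := by
  have hR : IsSelfAdjoint (CFC.sqrt S) := (CFC.sqrt_nonneg S).isSelfAdjoint
  have h : 0 ≤ CFC.sqrt S * T * CFC.sqrt S := hR.conjugate_nonneg hT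
  have := tr_nonneg h
  rwa [tr_mul_comm, ← mul_assoc, CFC.sqrt_mul_sqrt_self S hS] at this

/-- On a finite spectrum every function is continuous, so the functional calculus admits the
discontinuous sign function. -/
theorem finite_spectrum_real (T : Op H) : (spectrum ℝ T).Finite := by
  have h : (spectrum ℂ T).Finite := by
    have := Module.End.finite_spectrum T.toLinearMap
    rw [← AlgEquiv.spectrum_eq (Module.End.toContinuousLinearMap (𝕜 := ℂ) H)] at this
    exact this
  rw [← spectrum.preimage_algebraMap ℂ]
  exact h.preimage (Complex.ofReal_injective.injOn)

theorem exists_sign (X : Op H) (hX : IsSelfAdjoint X) :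
    ∃ S : Op H, -1 ≤ S ∧ S ≤ 1 ∧ CFC.abs X = X * S := by
  have hc (f : ℝ → ℝ) : ContinuousOn f (spectrum ℝ X) := X.finite_spectrum_real.continuousOn f
  let f : ℝ → ℝ := fun x => if 0 ≤ x then 1 else -1
  refine ⟨cfc f X, ?_, ?_, ?_⟩
  · rw [← map_one (algebraMap ℝ (Op H)), ← map_neg]
    refine algebraMap_le_cfc f (-1) X (fun x _ => ?_) (hc f)
    dsimp [f]; split_ifs <;> norm_num
  · refine cfc_le_one f X fun x _ => ?_
    dsimp [f]; split_ifs <;> norm_num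
  · rw [CFC.abs_eq_cfc_norm X hX]
    nth_rw 2 [← cfc_id ℝ X hX]
    rw [← cfc_mul _ _ X (hc _) (hc _)]
    refine cfc_congr fun x _ => ?_
    dsimp [f]
    split_ifs with h
    · simp [abs_of_nonneg h]
    · simp [abs_of_neg (not_le.mp h)]

theorem traceNorm_nonneg (T : Op H) : 0 ≤ T.traceNorm :=
  (Complex.nonneg_iff.mp (tr_nonneg (CFC.abs_nonneg T))).1

/-- With `S` the sign of `A - B`, the trace norm is `tr (A S) - tr (B S)`, and `-1 ≤ S ≤ 1` bounds
each term. -/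
theorem traceNorm_sub_le {A B : Op H} (hA : 0 ≤ A) (hB : 0 ≤ B) :
    (A - B).traceNorm ≤ A.tr.re + B.tr.re := by
  obtain ⟨S, hS₁, hS₂, hS⟩ := exists_sign (A - B) (hA.isSelfAdjoint.sub hB.isSelfAdjoint)
  have h₁ := tr_mul_nonneg hA (sub_nonneg.mpr hS₂)
  have h₂ := tr_mul_nonneg hB (sub_nonneg.mpr hS₁)
  rw [mul_sub, tr_sub, mul_one] at h₁
  rw [mul_sub, mul_neg, mul_one, sub_neg_eq_add, tr_add] at h₂
  have h₁ := (Complex.nonneg_iff.mp h₁).1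
  have h₂ := (Complex.nonneg_iff.mp h₂).1
  rw [traceNorm, hS, sub_mul, tr_sub]
  simp only [Complex.sub_re, Complex.add_re] at *
  linarith

theorem traceNorm_eq_posPart_add_negPart {X : Op H} (hX : IsSelfAdjoint X) :
    X.traceNorm = (X⁺).tr.re + (X⁻).tr.re := by
  rw [traceNorm, ← CFC.posPart_add_negPart X hX, tr_add, Complex.add_re]

end Op

namespace Superop.IsChannel

variable {H K : QSystem} {N : Superop H K}

theorem map_nonneg (hN : N.IsChannel) {T : Op H} (hT : 0 ≤ T) : 0 ≤ N T := by
  obtain ⟨⟨F, hF⟩, -⟩ := hN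
  rw [← hF]
  exact _root_.map_nonneg F hT

/-- Apply `N` to the positive and negative parts of `X`: their images stay positive and keep their
traces, which sum to `‖X‖₁`. -/
theorem traceNorm_map_le (hN : N.IsChannel) {X : Op H} (hX : IsSelfAdjoint X) :
    (N X).traceNorm ≤ X.traceNorm := by
  conv_lhs => rw [← CFC.posPart_sub_negPart X hX, map_sub]
  refine (Op.traceNorm_sub_le (hN.map_nonneg (CFC.posPart_nonneg X))
    (hN.map_nonneg (CFC.negPart_nonneg X))).trans_eq ?_
  rw [hN.2, hN.2, Op.traceNorm_eq_posPart_add_negPart hX]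

end Superop.IsChannel

/-! ### Unitary identifications and tensor powers -/

namespace Op

theorem ofIso_assocIso {H₁ H₂ H₃ : QSystem} (A : Op H₁) (B : Op H₂) (C : Op H₃) :
    Superop.ofIso (QSystem.assocIso H₁ H₂ H₃) ((A.tensor B).tensor C) =
      A.tensor (B.tensor C) := by
  refine ContinuousLinearMap.ext fun t => ?_
  obtain ⟨s, rfl⟩ := (QSystem.assocIso H₁ H₂ H₃).surjective t
  change QSystem.assocIso H₁ H₂ H₃ (((A.tensor B).tensor C)
    ((QSystem.assocIso H₁ H₂ H₃).symm (QSystem.assocIso H₁ H₂ H₃ s))) = _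
  rw [LinearIsometryEquiv.symm_apply_apply]
  refine LinearMap.congr_fun (f := (QSystem.assocIso H₁ H₂ H₃).toLinearMap ∘ₗ
    ((A.tensor B).tensor C).toLinearMap) (g := (A.tensor (B.tensor C)).toLinearMap ∘ₗ
    (QSystem.assocIso H₁ H₂ H₃).toLinearMap) (TensorProduct.ext_threefold fun x y z => ?_) s
  rfl

theorem ofIso_symm_apply {H K : QSystem} (U : H ≃ₗᵢ[ℂ] K) {A : Op H} {B : Op K}
    (h : Superop.ofIso U A = B) : Superop.ofIso U.symm B = A := by
  subst h
  ext x
  simp [Superop.ofIso]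

theorem ofIso_ridIso {H : QSystem} (A : Op H) :
    Superop.ofIso (QSystem.ridIso H) (A.tensor (1 : Op QSystem.unit)) = A := by
  ext x
  change QSystem.ridIso H ((A.tensor (1 : Op QSystem.unit)) ((QSystem.ridIso H).symm x)) = A x
  rw [QSystem.ridIso, TensorProduct.symm_ridIsometry_apply, tensor, TensorProduct.mapL_tmul,
    TensorProduct.ridIsometry_apply, TensorProduct.rid_tmul]
  exact one_smul ℂ (A x)

theorem trace_apply {H : QSystem} (A : Op H) : Superop.trace H A = A.tr • (1 : Op QSystem.unit) :=
  rfl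

end Op

theorem QSystem.finrank_pow (H : QSystem) (n : ℕ) :
    Module.finrank ℂ (H.pow n) = Module.finrank ℂ H ^ n := by
  induction n with
  | zero => exact Module.finrank_self ℂ
  | succ n ih =>
    rw [pow_succ, ← ih]
    exact Module.finrank_tensorProduct (R := ℂ) (S := ℂ) (M := H.pow n) (M' := H)

theorem QSystem.log2Dim_pow (H : QSystem) (n : ℕ) : (H.pow n).log2Dim = n * H.log2Dim := by
  rw [log2Dim, log2Dim, finrank_pow, Nat.cast_pow, Real.logb_pow, Real.toNNReal_mul (by positivity),
    Real.toNNReal_natCast]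

/-! ### Exact conversion by free operations -/

namespace QRT

/-- The operator `φ` is converted exactly into `ψ` by some free operation. -/
def Convertible (Q : QRT) {H K : QSystem} (φ : Op H) (ψ : Op K) : Prop :=
  ∃ M ∈ Q.free H K, M φ = ψ

variable {Q : QRT} {H H' K K' : QSystem}

namespace Convertible

theorem refl (φ : Op H) : Q.Convertible φ φ := ⟨_, Q.free_id H, rfl⟩

theorem trans {L : QSystem} {φ : Op H} {ψ : Op K} {χ : Op L} (h₁ : Q.Convertible φ ψ)
    (h₂ : Q.Convertible ψ χ) : Q.Convertible φ χ := by
  obtain ⟨M, hM, rfl⟩ := h₁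
  obtain ⟨N, hN, rfl⟩ := h₂
  exact ⟨_, Q.free_comp _ _ _ M hM N hN, rfl⟩

theorem tensor {φ : Op H} {ψ : Op K} {φ' : Op H'} {ψ' : Op K'} (h : Q.Convertible φ ψ)
    (h' : Q.Convertible φ' ψ') : Q.Convertible (φ.tensor φ') (ψ.tensor ψ') := by
  obtain ⟨M, hM, rfl⟩ := h
  obtain ⟨N, hN, rfl⟩ := h'
  exact ⟨_, Q.free_tensor _ _ _ _ M hM N hN, Superop.tensor_apply_tensor M N φ φ'⟩

theorem assoc (A : Op H) (B : Op K) (C : Op K') :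
    Q.Convertible ((A.tensor B).tensor C) (A.tensor (B.tensor C)) :=
  ⟨_, Q.free_assoc _ _ _, Op.ofIso_assocIso A B C⟩

theorem assoc_symm (A : Op H) (B : Op K) (C : Op K') :
    Q.Convertible (A.tensor (B.tensor C)) ((A.tensor B).tensor C) :=
  ⟨_, Q.free_assoc_symm _ _ _, Op.ofIso_symm_apply _ (Op.ofIso_assocIso A B C)⟩

theorem rid (A : Op H) : Q.Convertible (A.tensor (1 : Op QSystem.unit)) A :=
  ⟨_, Q.free_rid _, Op.ofIso_ridIso A⟩

theorem rid_symm (A : Op H) : Q.Convertible A (A.tensor (1 : Op QSystem.unit)) :=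
  ⟨_, Q.free_rid_symm _, Op.ofIso_symm_apply _ (Op.ofIso_ridIso A)⟩

theorem discard {φ : Op H} (hφ : φ.tr = 1) : Q.Convertible φ (1 : Op QSystem.unit) :=
  ⟨_, Q.free_trace H, by rw [Op.trace_apply, hφ, one_smul]⟩

theorem pow_add (φ : Op H) (a b : ℕ) :
    Q.Convertible ((φ.pow a).tensor (φ.pow b)) (φ.pow (a + b)) := by
  induction b with
  | zero => exact rid _
  | succ b ih => exact (assoc_symm _ _ _).trans (ih.tensor (refl φ))

theorem pow_add_symm (φ : Op H) (a b : ℕ) :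
    Q.Convertible (φ.pow (a + b)) ((φ.pow a).tensor (φ.pow b)) := by
  induction b with
  | zero => exact rid_symm _
  | succ b ih => exact (ih.tensor (refl φ)).trans (assoc _ _ _)

theorem pow_pow (φ : Op H) (n m : ℕ) : Q.Convertible ((φ.pow n).pow m) (φ.pow (n * m)) := by
  induction m with
  | zero => exact refl _
  | succ m ih => exact (ih.tensor (refl (φ.pow n))).trans (pow_add φ (n * m) n)

theorem pow_pow_symm (φ : Op H) (n m : ℕ) :
    Q.Convertible (φ.pow (n * m)) ((φ.pow n).pow m) := by
  induction m with
  | zero => exact refl _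
  | succ m ih => exact (pow_add_symm φ (n * m) n).trans (ih.tensor (refl (φ.pow n)))

/-- Surplus copies are traced out one at a time; unit trace makes each leave exactly the scalar `1`.
-/
theorem pow_of_le {φ : Op H} (hφ : φ.tr = 1) {a b : ℕ} (hab : a ≤ b) :
    Q.Convertible (φ.pow b) (φ.pow a) := by
  induction b, hab using Nat.le_induction with
  | base => exact refl _
  | succ b _ ih => exact (((refl (φ.pow b)).tensor (discard hφ)).trans (rid _)).trans ih

end Convertible

theorem isSelfAdjoint_of_mem_states {φ : Op H} (hφ : φ ∈ Q.states H) : IsSelfAdjoint φ :=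
  (Q.states_subset H hφ).1.isSelfAdjoint

/-! ### Comparison of asymptotic conversion rates -/

/-- Achievable rates are transported along free pre- and post-processing. -/
theorem mem_achievableRates_of_convertible {φ : Op H} {ψ : Op K} {φ' : Op H'} {ψ' : Op K'}
    (hφ : φ ∈ Q.states H) (hψ : ψ ∈ Q.states K) {r r' : NNReal} {k : ℕ → ℕ}
    {N : (j : ℕ) → Superop (H.pow (k j)) (K.pow ⌈r * (k j : NNReal)⌉₊)}
    (hN : ∀ j, N j ∈ Q.free _ _)
    (hlim : Filter.Tendsto
      (fun j => Op.traceNorm (N j (φ.pow (k j)) - ψ.pow ⌈r * (k j : NNReal)⌉₊))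
      Filter.atTop (nhds 0))
    {g k' : ℕ → ℕ} (hg : StrictMono g) (hk' : StrictMono k')
    (hpre : ∀ j, Q.Convertible (φ'.pow (k' j)) (φ.pow (k (g j))))
    (hpost : ∀ j, Q.Convertible (ψ.pow ⌈r * (k (g j) : NNReal)⌉₊)
      (ψ'.pow ⌈r' * (k' j : NNReal)⌉₊)) :
    r' ∈ Q.achievableRates φ' ψ' := by
  choose A hA hAφ using hpre
  choose B hB hBψ using hpost
  refine ⟨k', hk', fun j => B j ∘ₗ N (g j) ∘ₗ A j,
    fun j => Q.free_comp _ _ _ _ (Q.free_comp _ _ _ _ (hA j) _ (hN (g j))) _ (hB j),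
    squeeze_zero (fun _ => Op.traceNorm_nonneg _) (fun j => ?_) (hlim.comp hg.tendsto_atTop)⟩
  rw [LinearMap.comp_apply, LinearMap.comp_apply, hAφ, ← hBψ, ← map_sub]
  refine (Q.free_isChannel _ _ _ (hB j)).traceNorm_map_le (IsSelfAdjoint.sub ?_ ?_)
  · exact isSelfAdjoint_of_mem_states (Q.free_mapsTo _ _ _ (hN (g j)) (Q.states_pow H φ hφ _))
  · exact isSelfAdjoint_of_mem_states (Q.states_pow K ψ hψ _)

variable {φ : Op H} {ψ : Op K}

theorem tr_eq_one_of_mem_states (hφ : φ ∈ Q.states H) : φ.tr = 1 := (Q.states_subset H hφ).2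

/-- A protocol on `k` blocks of `n` copies is one on `n k` copies. Rounding is harmless, since `⌈r n
k⌉ ≤ n ⌈r k⌉`. -/
theorem rconv_pow_pow_le (hφ : φ ∈ Q.states H) (hψ : ψ ∈ Q.states K) {n : ℕ} (hn : 0 < n) :
    Q.rconv (φ.pow n) (ψ.pow n) ≤ Q.rconv φ ψ := by
  refine biSup_mono fun r => ?_
  rintro ⟨k, hk, N, hN, hlim⟩
  refine mem_achievableRates_of_convertible (Q.states_pow H φ hφ n) (Q.states_pow K ψ hψ n) hN hlim
    strictMono_id (k' := fun j => n * k j) (fun a b hab => Nat.mul_lt_mul_of_pos_left (hk hab) hn)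
    (fun j => Convertible.pow_pow_symm φ n (k j))
    fun j => (Convertible.pow_pow ψ n _).trans
      (Convertible.pow_of_le (tr_eq_one_of_mem_states hψ) (Nat.ceil_le.mpr ?_))
  push_cast
  calc r * (n * k j : NNReal) = n * (r * k j) := by ring
    _ ≤ _ := by gcongr; exact Nat.le_ceil _

/-- `m` copies need not fill whole blocks, so `q = ⌊m/n⌋ + 1` blocks are supplied and the excess
discarded. The output suffices because `n ⌈r' q⌉ ≤ r' (m + n) + n ≤ r m` for large `m`. -/
theorem mem_achievableRates_pow_pow (hφ : φ ∈ Q.states H) (hψ : ψ ∈ Q.states K) {n : ℕ}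
    (hn : 0 < n) {r r' : NNReal} (hr : r ∈ Q.achievableRates φ ψ) (hr' : r' < r) :
    r' ∈ Q.achievableRates (φ.pow n) (ψ.pow n) := by
  obtain ⟨k, hk, N, hN, hlim⟩ := hr
  -- From `m ≥ J` on, the gain `(r - r') m` covers the rounding loss `(r' + 1) n`.
  obtain ⟨J, hJ⟩ := exists_nat_ge (((r' : ℝ) + 1) * n / (r - r'))
  have hpos : (0 : ℝ) < r - r' := sub_pos.mpr hr'
  rw [div_le_iff₀ hpos] at hJ
  -- Steps of `n` make `k (g j)` grow by at least `n`, so the block counts strictly increase; the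
  -- shift gives `k (g j) ≥ J`.
  let g : ℕ → ℕ := fun j => n * j + J
  have hg : StrictMono g := fun a b hab =>
    Nat.add_lt_add_right (Nat.mul_lt_mul_of_pos_left hab hn) J
  have hk' : StrictMono fun j => k (g j) / n + 1 := by
    refine strictMono_nat_of_lt_succ fun j => Nat.add_lt_add_right ?_ 1
    have h : n + k (g j) ≤ k (g (j + 1)) := by
      have := hk.add_le_nat n (g j)
      rwa [show n + g j = g (j + 1) by dsimp [g]; ring] at this
    calc k (g j) / n < (n + k (g j)) / n := by rw [Nat.add_div_left _ hn]; exact Nat.lt_succ_self _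
      _ ≤ _ := Nat.div_le_div_right h
  refine mem_achievableRates_of_convertible hφ hψ hN hlim hg hk' (fun j => ?_) fun j => ?_
  · refine (Convertible.pow_pow φ n _).trans
      (Convertible.pow_of_le (tr_eq_one_of_mem_states hφ) ?_)
    exact (Nat.lt_mul_div_succ _ hn).le
  · refine (Convertible.pow_of_le (tr_eq_one_of_mem_states hψ) ?_).trans
      (Convertible.pow_pow_symm ψ n _)
    have hle : n * (k (g j) / n + 1) ≤ k (g j) + n := by
      rw [mul_add, mul_one]; exact Nat.add_le_add_right (Nat.mul_div_le _ _) n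
    have hJk : J ≤ k (g j) := (Nat.le_add_left J (n * j)).trans (hk.id_le _)
    set m := k (g j)
    set q := m / n + 1
    rify at hle hJk
    have h₁ : ((⌈r' * (q : NNReal)⌉₊ : ℕ) : ℝ) ≤ r' * q + 1 := by
      exact_mod_cast (Nat.ceil_lt_add_one (zero_le (a := r' * (q : NNReal)))).le
    have h₂ : (r : ℝ) * m ≤ (⌈r * (m : NNReal)⌉₊ : ℕ) := by
      exact_mod_cast Nat.le_ceil (r * (m : NNReal))
    have h₃ : ((r' : ℝ) + 1) * n ≤ m * (r - r') := hJ.trans (by gcongr)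
    have h₄ : (n : ℝ) * (⌈r' * (q : NNReal)⌉₊ : ℕ) ≤ n * (r' * q + 1) := by gcongr
    have h₅ : (r' : ℝ) * (n * q) ≤ r' * (m + n) := by gcongr
    have h₆ : (n : ℝ) * (⌈r' * (q : NNReal)⌉₊ : ℕ) ≤ (⌈r * (m : NNReal)⌉₊ : ℕ) := by linarith
    exact_mod_cast h₆

theorem rconv_le_rconv_pow_pow (hφ : φ ∈ Q.states H) (hψ : ψ ∈ Q.states K) {n : ℕ} (hn : 0 < n) :
    Q.rconv φ ψ ≤ Q.rconv (φ.pow n) (ψ.pow n) := by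
  refine iSup₂_le fun r hr => le_of_forall_lt fun c hc => ?_
  lift c to NNReal using (hc.trans ENNReal.coe_lt_top).ne
  obtain ⟨r', hcr', hr'⟩ := exists_between (ENNReal.coe_lt_coe.mp hc)
  exact (ENNReal.coe_lt_coe.mpr hcr').trans_le
    (le_iSup₂_of_le r' (mem_achievableRates_pow_pow hφ hψ hn hr hr') le_rfl)

end QRT

theorem mainTheorem8 (Q : QRT) (H : QSystem) (ψ : Op H) (hψ : ψ ∈ Q.states H) (n : ℕ) :
    Q.distillable QSystem.log2Dim (ψ.pow n) ≤ (n : ENNReal) * Q.distillable QSystem.log2Dim ψ ∧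
      Q.cost QSystem.log2Dim (ψ.pow n) ≤ (n : ENNReal) * Q.cost QSystem.log2Dim ψ := by
  have hdim : ((H.pow n).log2Dim : ENNReal) = n * H.log2Dim := by
    rw [QSystem.log2Dim_pow, ENNReal.coe_mul, ENNReal.coe_natCast]
  obtain rfl | hn := Nat.eq_zero_or_pos n
  -- The zeroth power lives on `ℂ`, where `log₂ dim = 0` makes both quantities vanish.
  · rw [Nat.cast_zero, zero_mul] at hdim
    constructor
    · refine (iInf₂_le (ψ.pow 0) (Q.states_pow H ψ hψ 0)).trans ?_
      rw [hdim, mul_zero]; exact zero_le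
    · refine (iInf₂_le (ψ.pow 0) (Q.states_pow H ψ hψ 0)).trans ?_
      rw [hdim, ENNReal.zero_div]; exact zero_le
  · have hn₀ : (n : ENNReal) ≠ 0 := by exact_mod_cast hn.ne'
    have hn₁ : (n : ENNReal) ≠ ⊤ := ENNReal.natCast_ne_top n
    constructor
    · rw [QRT.distillable, QRT.distillable, ENNReal.mul_iInf_of_ne hn₀ hn₁]
      refine le_iInf fun φ => ?_
      rw [ENNReal.mul_iInf_of_ne hn₀ hn₁]
      refine le_iInf fun hφ => (iInf₂_le (φ.pow n) (Q.states_pow H φ hφ n)).trans ?_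
      rw [hdim, mul_left_comm]
      gcongr
      exact QRT.rconv_pow_pow_le hψ hφ hn
    · rw [QRT.cost, QRT.cost, ENNReal.mul_iInf_of_ne hn₀ hn₁]
      refine le_iInf fun φ => ?_
      rw [ENNReal.mul_iInf_of_ne hn₀ hn₁]
      refine le_iInf fun hφ => (iInf₂_le (φ.pow n) (Q.states_pow H φ hφ n)).trans ?_
      rw [hdim, mul_div_assoc]
      gcongr
      exact QRT.rconv_le_rconv_pow_pow hφ hψ hn
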